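/- Let $n\ge 0$, let $A=\mathbb{Z}^n$, let $\varphi\colon A\to A$ be an injective homomorphism, and let $$G=\mathbb{Z}^n*_\varphi=\langle A,t\mid tat^{-1}=\varphi(a),\ a\in A\rangle$$ be the corresponding ascending HNN extension. Let $\varphi_{\mathbb{Q}}$ be the $\mathbb{Q}$-linear map of $\mathbb{Q}^n$ induced by $\varphi$, and let $\{0\}=V_0<V_1<\dots<V_l=\mathbb{Q}^n$ be any composition series of $\mathbb{Q}^n$ as a $\mathbb{Q}[\varphi_{\mathbb{Q}}]$-module, i.e. a chain of $\varphi_{\mathbb{Q}}$-invariant subspaces such that no $\varphi_{\mathbb{Q}}$-invariant subspace lies strictly between consecutive terms. Put $A_i=V_i\cap A$, so that $\{0\}=A_0<A_1<\dots<A_l=A$ is a chain of $\varphi$-invariant subgroups and each $A_i/A_{i-1}$ ($1\le i\le l$) is free abelian; let $n_i$ be its rank and let $f_i(x)\in\mathbb{Z}[x]$ be the characteristic polynomial of the endomorphism of $A_i/A_{i-1}$ induced by $\varphi$. For a prime $p$ and $0\le i<l$ put $$K_{p,i}=\{a\in A\mid \varphi^j(a)\in A_i+pA\text{ for some }j\ge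 0\}.$$ A group is cyclic subgroup separable if each of its cyclic subgroups is closed in the profinite topology, i.e. the topology whose basic open sets are the cosets of the finite-index normal subgroups. Then each $f_i$ is monic of degree $n_i$ and irreducible over $\mathbb{Q}$, the characteristic polynomial of $\varphi$ is $f_\varphi=f_1f_2\cdots f_l$, and the following are equivalent: 1. $G$ is cyclic subgroup separable; 2. there is no prime $p$ and $0\le i<l$ with $A_{i+1}\subseteq K_{p,i}$; 3. there is no prime $p$ and $1\le i\le l$ with $f_i(x)\equiv x^{n_i}\pmod p$. -/

import Mathlib

namespace AscHNN

/-! ### Separability in the profinite topology -/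

/-- The profinite topology on a group `G`: the topology whose basic open sets are the cosets
of the normal subgroups of finite index. -/
abbrev profiniteTopology (G : Type*) [Group G] : TopologicalSpace G :=
  TopologicalSpace.generateFrom
    {U : Set G | ∃ (N : Subgroup G) (g : G), N.Normal ∧ N.FiniteIndex ∧ U = {x | g⁻¹ * x ∈ N}}

/-- A subset of a group is separable if it is closed in the profinite topology. -/
def IsSeparableSet {G : Type*} [Group G] (S : Set G) : Prop :=
  @IsClosed G (profiniteTopology G) S

/-- A group is cyclic subgroup separable if every cyclic subgroup is separable. -/
def IsCyclicSubgroupSeparable (G : Type*) [Group G] : Prop :=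
  ∀ g : G, IsSeparableSet (Subgroup.zpowers g : Set G)

/-! ### Ascending HNN extensions -/

/-- The isomorphism of `H` (as the full subgroup of itself) onto the image of an injective
endomorphism `ψ`, given by `ψ`. -/
noncomputable def rangeEquiv {H : Type*} [Group H] (ψ : H →* H) (hψ : Function.Injective ψ) :
    (⊤ : Subgroup H) ≃* ψ.range :=
  Subgroup.topEquiv.trans (MonoidHom.ofInjective hψ)

/-- The ascending HNN extension `H *_ψ = ⟨H, t ∣ t h t⁻¹ = ψ h, h ∈ H⟩`. -/
abbrev HNN {H : Type*} [Group H] (ψ : H →* H) (hψ : Function.Injective ψ) : Type _ :=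
  HNNExtension H ⊤ ψ.range (rangeEquiv ψ hψ)

/-- The ascending HNN extension `ℤⁿ *_φ` (with `ℤⁿ` written multiplicatively). -/
abbrev ZHNN {n : ℕ} (φ : Module.End ℤ (Fin n → ℤ)) (hφ : Function.Injective φ) : Type :=
  HNN (H := Multiplicative (Fin n → ℤ)) (AddMonoidHom.toMultiplicative φ.toAddMonoidHom) hφ

/-! ### The linear algebra of `φ` -/

section

variable {n : ℕ} (φ : Module.End ℤ (Fin n → ℤ))

/-- The inclusion `ℤⁿ ⊆ ℚⁿ`. -/
def toRat (a : Fin n → ℤ) : Fin n → ℚ := fun k => (a k : ℚ)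

/-- The `ℚ`-linear map `φ_ℚ : ℚⁿ → ℚⁿ` induced by `φ` (it has the same matrix). -/
noncomputable def ratEnd : Module.End ℚ (Fin n → ℚ) :=
  Matrix.toLin' ((LinearMap.toMatrix' φ).map (Int.cast : ℤ → ℚ))

theorem ratEnd_toRat (a : Fin n → ℤ) : ratEnd φ (toRat a) = toRat (φ a) := by
  have h : φ a = (LinearMap.toMatrix' φ).mulVec a := by
    rw [LinearMap.toMatrix'_mulVec]
  rw [h]
  ext k
  simp [ratEnd, toRat, Matrix.mulVec, dotProduct]

/-- `ℚⁿ` as a `ℚ[φ_ℚ]`-module, that is, as a `ℚ[X]`-module with `X` acting as `φ_ℚ`.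
Its submodules are the `φ_ℚ`-invariant subspaces of `ℚⁿ`. -/
abbrev RatModule : Type := Module.AEval' (ratEnd φ)

/-- The subgroup `V ∩ ℤⁿ` of `ℤⁿ`, for a `φ_ℚ`-invariant subspace `V` of `ℚⁿ`. -/
def inter (V : Submodule (Polynomial ℚ) (RatModule φ)) : Submodule ℤ (Fin n → ℤ) where
  carrier := {a | Module.AEval'.of (ratEnd φ) (toRat a) ∈ V}
  zero_mem' := by
    have h : toRat (0 : Fin n → ℤ) = 0 := by ext; simp [toRat]
    simp [h]
  add_mem' := by
    intro a b ha hb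
    have h : toRat (a + b) = toRat a + toRat b := by ext; simp [toRat]
    simpa [h] using V.add_mem ha hb
  smul_mem' := by
    intro c a ha
    have h : toRat (c • a) = c • toRat a := by ext; simp [toRat]
    change Module.AEval'.of (ratEnd φ) (toRat (c • a)) ∈ V
    rw [h, map_zsmul]
    exact V.toAddSubgroup.zsmul_mem ha c

variable (U V : Submodule (Polynomial ℚ) (RatModule φ))

theorem mem_inter {a : Fin n → ℤ} :
    a ∈ inter φ V ↔ Module.AEval'.of (ratEnd φ) (toRat a) ∈ V := Iff.rfl

theorem inter_invariant : ∀ a ∈ inter φ V, φ a ∈ inter φ V := by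
  intro a ha
  rw [mem_inter] at ha ⊢
  rw [← ratEnd_toRat, ← Module.AEval'.X_smul_of]
  exact V.smul_mem _ ha

/-- The quotient `(V ∩ ℤⁿ) / (U ∩ ℤⁿ)`, meant for `U ≤ V`. -/
abbrev Factor : Type := inter φ V ⧸ (inter φ U).submoduleOf (inter φ V)

/-- The endomorphism of `(V ∩ ℤⁿ) / (U ∩ ℤⁿ)` induced by `φ`. -/
def factorEnd : Module.End ℤ (Factor φ U V) :=
  Submodule.mapQ _ _ (φ.restrict (inter_invariant φ V)) (by
    intro a ha
    exact inter_invariant φ U _ ha)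

instance : Module.Free ℤ (Factor φ U V) := by
  have : Module.IsTorsionFree ℤ (Factor φ U V) := by
    rw [Module.isTorsionFree_iff_smul_eq_zero]
    intro m x hx
    obtain ⟨a, rfl⟩ := Submodule.Quotient.mk_surjective _ x
    by_contra hne
    push Not at hne
    apply hne.2
    rw [← Submodule.Quotient.mk_smul, Submodule.Quotient.mk_eq_zero] at hx
    rw [Submodule.Quotient.mk_eq_zero]
    have hx' : Module.AEval'.of (ratEnd φ) (toRat (m • (a : Fin n → ℤ))) ∈ U := hx
    change Module.AEval'.of (ratEnd φ) (toRat (a : Fin n → ℤ)) ∈ U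
    have h : toRat (a : Fin n → ℤ) = ((m : ℚ)⁻¹) • toRat (m • (a : Fin n → ℤ)) := by
      have : (m : ℚ) ≠ 0 := by exact_mod_cast hne.1
      ext k
      simp [toRat, this]
    rw [h, map_smul, ← Module.AEval.C_smul]
    exact U.smul_mem _ hx'
  exact Module.free_of_finite_type_torsion_free'

/-- The characteristic polynomial of the endomorphism of `(V ∩ ℤⁿ) / (U ∩ ℤⁿ)`
induced by `φ`. -/
noncomputable def factorPoly : Polynomial ℤ := (factorEnd φ U V).charpoly

/-- The set `{a ∈ ℤⁿ ∣ φ ^ j (a) ∈ B + q ℤⁿ for some j ≥ 0}`. -/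
def absorbed (B : Submodule ℤ (Fin n → ℤ)) (q : ℕ) : Set (Fin n → ℤ) :=
  {a | ∃ j : ℕ, ∃ b ∈ B, ∃ c : Fin n → ℤ, (φ ^ j) a = b + (q : ℤ) • c}

end

end AscHNN

namespace AscHNN

open Topology

/-! ### Finite quotients -/

section Separability

variable {G : Type*} [Group G]

/-! Write D(q) for `eventuallyDivisible φ q`, the set of a in A with some φ^j(a) in qA. All three
conditions are tied to the existence of a prime p and a nonzero a lying in D(p^K) for every K.

If f_i ≡ x^m mod p, then f_i(φ) kills some nonzero a, because it maps A_i into the smaller-rank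
A_{i-1}. Hence φ^m(a) = p·g(φ)(a), and iterating puts φ^{mu}(a) in p^u A. As t conjugates a to φ(a),
the image of a in every finite quotient has order prime to p and so lies in the image of ⟨pa⟩,
although a is not in ⟨pa⟩ (`factorPoly_map_ne_X_pow`).

If A_{i+1} ⊆ K_{p,i}, then φ is nilpotent on the next factor modulo p, so its characteristic
polynomial there is a power of x (`factorPoly_map_eq_X_pow`).

Suppose that for each p the D(p^K) intersect in 0. Cyclic subgroups of A are then separated by the
actions of G on the finite sets A/D(q) (`isCyclicSubgroupSeparable_of_eventuallyDivisible`). This is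
enough for G: elements of exponent sum zero are conjugate into A, and the others need only residual
finiteness. A nonzero e in all D(p^K) instead lies in some A_{i+1} outside A_i and, by simplicity of
V_{i+1}/V_i, forces A_{i+1} ⊆ K_{p,i} (`inter_subset_absorbed`).

Irreducibility of f_i comes from V_i/V_{i-1} ≅ ℚ[X]/(π) by comparing degrees. -/

theorem exists_coset_subset_of_isOpen {U : Set G} (hU : IsOpen[profiniteTopology G] U) :
    ∀ x ∈ U, ∃ N : Subgroup G, N.Normal ∧ N.FiniteIndex ∧ ∀ y, x⁻¹ * y ∈ N → y ∈ U := by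
  induction hU with
  | basic s hs =>
    obtain ⟨N, g, hN, hfi, rfl⟩ := hs
    refine fun x hx => ⟨N, hN, hfi, fun y hy => ?_⟩
    have := N.mul_mem hx hy
    simpa [mul_assoc] using this
  | univ => exact fun x _ => ⟨⊤, inferInstance, inferInstance, fun _ _ => trivial⟩
  | inter s t _ _ hs ht =>
    rintro x ⟨hxs, hxt⟩
    obtain ⟨N, hN, hNf, h⟩ := hs x hxs
    obtain ⟨M, hM, hMf, h'⟩ := ht x hxt
    exact ⟨N ⊓ M, inferInstance, inferInstance, fun y hy => ⟨h y hy.1, h' y hy.2⟩⟩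
  | sUnion S _ ih =>
    rintro x ⟨s, hs, hx⟩
    obtain ⟨N, hN, hNf, h⟩ := ih s hs x hx
    exact ⟨N, hN, hNf, fun y hy => ⟨s, hs, h y hy⟩⟩

theorem IsSeparableSet.exists_normal {S : Set G} (hS : IsSeparableSet S) {x : G} (hx : x ∉ S) :
    ∃ N : Subgroup G, N.Normal ∧ N.FiniteIndex ∧ ∀ y ∈ S, x⁻¹ * y ∉ N := by
  have hU : IsOpen[profiniteTopology G] Sᶜ :=
    (@isOpen_compl_iff _ _ (profiniteTopology G)).2 hS
  obtain ⟨N, hN, hNf, h⟩ := exists_coset_subset_of_isOpen hU x hx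
  exact ⟨N, hN, hNf, fun y hy hxy => h y hxy hy⟩

theorem isSeparableSet_of_exists_normal {S : Set G}
    (h : ∀ x ∉ S, ∃ N : Subgroup G, N.Normal ∧ N.FiniteIndex ∧ ∀ y ∈ S, x⁻¹ * y ∉ N) :
    IsSeparableSet S := by
  refine (@isOpen_compl_iff _ _ (profiniteTopology G)).1 ?_
  refine (@isOpen_iff_forall_mem_open _ (profiniteTopology G) _).2 fun x hx => ?_
  obtain ⟨N, hN, hNf, hy⟩ := h x hx
  refine ⟨{y | x⁻¹ * y ∈ N}, fun y hxy hyS => hy y hyS hxy,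
    TopologicalSpace.GenerateOpen.basic _ ⟨N, x, hN, hNf, rfl⟩, ?_⟩
  simp [N.one_mem]

/-- `x` lies outside the cyclic subgroup of `g` in some finite quotient. -/
def SeparatedFromZPowers (g x : G) : Prop :=
  ∃ N : Subgroup G, N.Normal ∧ N.FiniteIndex ∧ ∀ k : ℤ, x⁻¹ * g ^ k ∉ N

theorem isCyclicSubgroupSeparable_of_separated
    (h : ∀ g x : G, (∀ k : ℤ, x ≠ g ^ k) → SeparatedFromZPowers g x) :
    IsCyclicSubgroupSeparable G := by
  refine fun g => isSeparableSet_of_exists_normal fun x hx => ?_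
  obtain ⟨N, hN, hNf, hy⟩ := h g x fun k hk => hx ⟨k, hk.symm⟩
  refine ⟨N, hN, hNf, ?_⟩
  rintro _ ⟨k, rfl⟩
  exact hy k

theorem SeparatedFromZPowers.of_hom {Q : Type*} [Group Q] [Finite Q] (f : G →* Q) {g x : G}
    (h : ∀ k : ℤ, f x ≠ f g ^ k) : SeparatedFromZPowers g x := by
  refine ⟨f.ker, inferInstance, inferInstance, fun k hk => h k ?_⟩
  rw [MonoidHom.mem_ker, map_mul, map_inv, inv_mul_eq_one, map_zpow] at hk
  exact hk

theorem SeparatedFromZPowers.of_conj (c : G) {g x : G}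
    (h : SeparatedFromZPowers (c * g * c⁻¹) (c * x * c⁻¹)) : SeparatedFromZPowers g x := by
  obtain ⟨N, hN, hNf, h⟩ := h
  refine ⟨N, hN, hNf, fun k hk => h k ?_⟩
  have := hN.conj_mem _ hk c
  rw [conj_zpow]
  convert this using 1
  group

theorem SeparatedFromZPowers.of_int_hom (τ : G →* Multiplicative ℤ) {g x : G}
    (h : ∀ k : ℤ, τ x ≠ τ g ^ k) : SeparatedFromZPowers g x := by
  set m := (τ g).toAdd with hm
  set d := (τ x).toAdd with hd
  have hmd : ¬ m ∣ d := by
    rintro ⟨s, hs⟩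
    refine h s (Multiplicative.toAdd.injective ?_)
    rw [toAdd_zpow, ← hm, ← hd, hs, smul_eq_mul, mul_comm]
  -- A modulus in which d stays outside the subgroup generated by m: |m| itself, or |d| + 1 when m =
  -- 0.
  obtain ⟨N, hN0, hN⟩ : ∃ N : ℕ, N ≠ 0 ∧ ¬ ∃ k : ℤ, (N : ℤ) ∣ d - k * m := by
    by_cases hm0 : m = 0
    · refine ⟨d.natAbs + 1, by omega, ?_⟩
      rintro ⟨k, hk⟩
      rw [hm0, mul_zero, sub_zero] at hk
      have hd0 : d ≠ 0 := fun hd0 => hmd (by simp [hd0])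
      have := Int.natAbs_le_of_dvd_ne_zero hk hd0
      rw [Int.natAbs_natCast] at this
      omega
    · refine ⟨m.natAbs, by omega, ?_⟩
      rintro ⟨k, hk⟩
      rw [Int.natCast_natAbs, abs_dvd] at hk
      exact hmd (by simpa using dvd_add hk (Dvd.intro_left k rfl))
  have : NeZero N := ⟨hN0⟩
  refine .of_hom ((AddMonoidHom.toMultiplicative (Int.castAddHom (ZMod N))).comp τ) fun k hk => ?_
  refine hN ⟨k, ?_⟩
  have h2 := congrArg Multiplicative.toAdd hk
  rw [toAdd_zpow] at h2
  change ((d : ℤ) : ZMod N) = k • ((m : ℤ) : ZMod N) at h2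
  rw [← ZMod.intCast_zmod_eq_zero_iff_dvd]
  push_cast
  rw [h2]
  simp

/-- A group in which every nontrivial element survives in a finite quotient. -/
def IsResiduallyFinite (G : Type*) [Group G] : Prop :=
  ∀ x : G, x ≠ 1 → ∃ N : Subgroup G, N.Normal ∧ N.FiniteIndex ∧ x ∉ N

/-- If τ(x) = τ(g)^s, only k = s could give x = g^k. A finite-index N missing x·g^(-s) is refined by
the value of τ modulo |m|·[G : N], where m is the exponent of τ(g): this forces k ≡ s modulo the
index, so g^k and g^s agree modulo N. -/
theorem IsResiduallyFinite.separated (hG : IsResiduallyFinite G) (τ : G →* Multiplicative ℤ)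
    {g x : G} (hg : τ g ≠ 1) (hx : ∀ k : ℤ, x ≠ g ^ k) : SeparatedFromZPowers g x := by
  by_cases h : ∀ k : ℤ, τ x ≠ τ g ^ k
  · exact .of_int_hom τ h
  push Not at h
  obtain ⟨s, hs⟩ := h
  have hy : x * g ^ (-s) ≠ 1 := by
    intro hy
    refine hx s ?_
    rwa [zpow_neg, mul_inv_eq_one] at hy
  obtain ⟨N, hN, hNf, hxN⟩ := hG _ hy
  set m := (τ g).toAdd with hm
  have hm0 : m ≠ 0 := fun h0 => hg (Multiplicative.toAdd.injective h0)
  set e := N.index with he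
  have he0 : e ≠ 0 := hNf.index_ne_zero
  have hpow : ∀ y : G, y ^ e ∈ N := fun y => Subgroup.pow_index_mem N y
  set r : ℕ := m.natAbs * e with hr
  have : NeZero r := ⟨by positivity⟩
  let f : G →* Multiplicative (ZMod r) :=
    (AddMonoidHom.toMultiplicative (Int.castAddHom (ZMod r))).comp τ
  refine ⟨N ⊓ f.ker, inferInstance, inferInstance, fun k hk => ?_⟩
  have h1 : x⁻¹ * g ^ k ∈ N := hk.1
  have h2 : f (x⁻¹ * g ^ k) = 1 := hk.2
  have h3 : (τ (x⁻¹ * g ^ k)).toAdd = (k - s) * m := by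
    rw [map_mul, map_inv, map_zpow, hs, ← zpow_neg, ← zpow_add, toAdd_zpow, smul_eq_mul]
    ring
  have h4 : (((k - s) * m : ℤ) : ZMod r) = 0 := by
    rw [← h3]
    exact congrArg Multiplicative.toAdd h2
  rw [ZMod.intCast_zmod_eq_zero_iff_dvd, hr] at h4
  have h5 : (e : ℤ) ∣ k - s := by
    push_cast at h4
    have h6 : m * e ∣ m * (k - s) := by
      rw [mul_comm m (k - s)]
      refine dvd_trans ?_ h4
      exact mul_dvd_mul ((dvd_abs m m).2 dvd_rfl) dvd_rfl
    exact (mul_dvd_mul_iff_left hm0).1 h6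
  obtain ⟨u, hu⟩ := h5
  have h7 : g ^ (k - s) ∈ N := by
    rw [hu, zpow_mul, zpow_natCast]
    exact N.zpow_mem (hpow g) u
  apply hxN
  have h8 : x⁻¹ * g ^ s ∈ N := by
    have := N.mul_mem h1 (N.inv_mem h7)
    rwa [mul_assoc, ← zpow_neg, ← zpow_add, show k + -(k - s) = s by ring] at this
  have h10 := hN.conj_mem _ (N.inv_mem h8) x
  have h11 : x * g ^ (-s) = x * (x⁻¹ * g ^ s)⁻¹ * x⁻¹ := by
    simp [mul_assoc]
  rw [h11]
  exact h10

end Separability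

/-! ### Ascending HNN extensions -/

section HNN

variable {H : Type*} [Group H] {ψ : H →* H} {hψ : Function.Injective ψ}

theorem t_mul_of' (a : H) :
    (HNNExtension.t : HNN ψ hψ) * HNNExtension.of a = HNNExtension.of (ψ a) * HNNExtension.t :=
  HNNExtension.t_mul_of (⟨a, trivial⟩ : (⊤ : Subgroup H))

theorem t_pow_mul_of (a : H) (k : ℕ) :
    (HNNExtension.t : HNN ψ hψ) ^ k * HNNExtension.of a =
      HNNExtension.of (ψ^[k] a) * HNNExtension.t ^ k := by
  induction k generalizing a with
  | zero => simp
  | succ k ih =>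
    rw [pow_succ, mul_assoc, t_mul_of', ← mul_assoc, ih, Function.iterate_succ_apply, mul_assoc]

/-- The homomorphism to `Q` given on `H` by `f` and on the stable letter by `x`. -/
noncomputable def HNN.lift {Q : Type*} [Group Q] (f : H →* Q) (x : Q) (hx : ∀ a, x * f a = f (ψ a) * x) :
    HNN ψ hψ →* Q :=
  HNNExtension.lift f x fun a => hx a

@[simp]
theorem HNN.lift_of {Q : Type*} [Group Q] (f : H →* Q) (x : Q)
    (hx : ∀ a, x * f a = f (ψ a) * x) (a : H) :
    (HNN.lift f x hx : HNN ψ hψ →* Q) (HNNExtension.of a) = f a :=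
  HNNExtension.lift_of _ _ _ _

@[simp]
theorem HNN.lift_t {Q : Type*} [Group Q] (f : H →* Q) (x : Q)
    (hx : ∀ a, x * f a = f (ψ a) * x) :
    (HNN.lift f x hx : HNN ψ hψ →* Q) HNNExtension.t = x :=
  HNNExtension.lift_t _ _ _

/-- The exponent sum of the stable letter. -/
noncomputable def HNN.height (ψ : H →* H) (hψ : Function.Injective ψ) : HNN ψ hψ →* Multiplicative ℤ :=
  HNN.lift 1 (Multiplicative.ofAdd 1) (by simp)

/-- Conjugation by a high power of t removes the negative powers of t to the left of base elements.
Asking for all large k makes the induction on products and inverses possible. -/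
theorem HNN.exists_conj (x : HNN ψ hψ) : ∃ k₀ : ℕ, ∀ k ≥ k₀, ∃ a : H,
    HNNExtension.t ^ k * x * (HNNExtension.t ^ k)⁻¹ =
      HNNExtension.of a * HNNExtension.t ^ (HNN.height ψ hψ x).toAdd := by
  induction x using HNNExtension.induction_on with
  | of a =>
    refine ⟨0, fun k _ => ⟨ψ^[k] a, ?_⟩⟩
    rw [t_pow_mul_of]
    simp [HNN.height]
  | t =>
    refine ⟨0, fun k _ => ⟨1, ?_⟩⟩
    rw [HNN.height, HNN.lift_t, ← pow_succ, pow_succ']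
    simp
  | mul x y hx hy =>
    obtain ⟨k, hk⟩ := hx
    obtain ⟨l, hl⟩ := hy
    set m := (HNN.height ψ hψ x).toAdd with hm
    -- Moving t^m past the conjugate of y by t^j changes the exponent j to j + m, which must still
    -- be at least l.
    refine ⟨max k (l + m.natAbs), fun j hj => ?_⟩
    obtain ⟨a, ha⟩ := hk j (le_trans (le_max_left _ _) hj)
    have hj' : l + m.natAbs ≤ j := le_trans (le_max_right _ _) hj
    obtain ⟨i, hi⟩ : ∃ i : ℕ, (i : ℤ) = j + m := ⟨(j + m).toNat, by omega⟩
    obtain ⟨b, hb⟩ := hl i (by omega)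
    refine ⟨a * b, ?_⟩
    have e : (HNNExtension.t : HNN ψ hψ) ^ m * (HNNExtension.t ^ j * y * (HNNExtension.t ^ j)⁻¹) =
        (HNNExtension.t ^ i * y * (HNNExtension.t ^ i)⁻¹) * HNNExtension.t ^ m := by
      simp only [← zpow_natCast, ← zpow_neg, hi, ← mul_assoc, ← zpow_add]
      rw [add_comm m j, mul_assoc _ _ (HNNExtension.t ^ m), ← zpow_add]
      congr 2
      ring
    calc HNNExtension.t ^ j * (x * y) * (HNNExtension.t ^ j)⁻¹
        = HNNExtension.t ^ j * x * (HNNExtension.t ^ j)⁻¹ *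
          (HNNExtension.t ^ j * y * (HNNExtension.t ^ j)⁻¹) := by group
      _ = _ := by
        rw [ha, mul_assoc, e, hb, map_mul, map_mul, toAdd_mul, ← hm, add_comm m, zpow_add]
        simp only [mul_assoc]
  | inv x hx =>
    obtain ⟨k, hk⟩ := hx
    set m := (HNN.height ψ hψ x).toAdd with hm
    refine ⟨k + m.natAbs, fun j hj => ?_⟩
    obtain ⟨i, hi⟩ : ∃ i : ℕ, (i : ℤ) = j - m := ⟨(j - m).toNat, by omega⟩
    obtain ⟨a, ha⟩ := hk i (by omega)
    refine ⟨a⁻¹, ?_⟩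
    rw [map_inv, map_inv, toAdd_inv, ← hm, zpow_neg]
    rw [← zpow_natCast, hi] at ha
    rw [← zpow_natCast]
    have e : HNNExtension.of a = HNNExtension.t ^ ((j : ℤ) - m) * x *
        (HNNExtension.t ^ ((j : ℤ) - m))⁻¹ * (HNNExtension.t ^ m)⁻¹ := by rw [ha]; group
    rw [e]
    group

theorem HNN.exists_conj_eq_of {x : HNN ψ hψ} (hx : HNN.height ψ hψ x = 1) :
    ∃ k₀ : ℕ, ∀ k ≥ k₀, ∃ a : H,
      HNNExtension.t ^ k * x * (HNNExtension.t ^ k)⁻¹ = HNNExtension.of a := by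
  obtain ⟨k₀, h⟩ := HNN.exists_conj x
  refine ⟨k₀, fun k hk => ?_⟩
  obtain ⟨a, ha⟩ := h k hk
  exact ⟨a, by simpa [hx] using ha⟩

/-- An element of nonzero exponent sum survives in a cyclic quotient; any other is conjugate into
the base. -/
theorem HNN.isResiduallyFinite
    (h : ∀ a : H, a ≠ 1 → ∃ N : Subgroup (HNN ψ hψ), N.Normal ∧ N.FiniteIndex ∧
      HNNExtension.of a ∉ N) : IsResiduallyFinite (HNN ψ hψ) := by
  intro x hx
  by_cases hx' : HNN.height ψ hψ x = 1
  · obtain ⟨k, hk⟩ := HNN.exists_conj_eq_of hx'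
    obtain ⟨a, ha⟩ := hk k le_rfl
    obtain ⟨N, hN, hNf, haN⟩ := h a (by
      rintro rfl
      rw [map_one, mul_inv_eq_one] at ha
      exact hx (by simpa using ha))
    refine ⟨N, hN, hNf, fun hxN => haN ?_⟩
    rw [← ha]
    exact hN.conj_mem _ hxN _
  · obtain ⟨N, hN, hNf, h⟩ := SeparatedFromZPowers.of_int_hom (HNN.height ψ hψ)
      (g := 1) (x := x) (by simpa using hx')
    exact ⟨N, hN, hNf, fun hxN => h 0 (by simpa using hxN)⟩

/-- To separate the cyclic subgroups of an ascending HNN extension, it suffices to separate those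
of the base group. -/
theorem HNN.isCyclicSubgroupSeparable
    (h : ∀ g a : H, (∀ k : ℤ, a ≠ g ^ k) →
      SeparatedFromZPowers (HNNExtension.of g : HNN ψ hψ) (HNNExtension.of a)) :
    IsCyclicSubgroupSeparable (HNN ψ hψ) := by
  refine isCyclicSubgroupSeparable_of_separated fun g x hgx => ?_
  by_cases hg : HNN.height ψ hψ g = 1
  · by_cases hx : HNN.height ψ hψ x = 1
    · obtain ⟨k, hk⟩ := HNN.exists_conj_eq_of hg
      obtain ⟨l, hl⟩ := HNN.exists_conj_eq_of hx
      obtain ⟨a, ha⟩ := hk (max k l) (le_max_left _ _)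
      obtain ⟨b, hb⟩ := hl (max k l) (le_max_right _ _)
      refine .of_conj (HNNExtension.t ^ max k l) ?_
      rw [ha, hb]
      refine h a b fun s hs => hgx s ?_
      rw [hs, map_zpow, ← ha, conj_zpow] at hb
      simpa using hb
    · exact .of_int_hom (HNN.height ψ hψ) (by simpa [hg] using hx)
  · refine IsResiduallyFinite.separated (HNN.isResiduallyFinite fun a ha => ?_)
      (HNN.height ψ hψ) hg hgx
    obtain ⟨N, hN, hNf, h⟩ := h 1 a (by simpa using ha)
    exact ⟨N, hN, hNf, fun haN => h 0 (by simpa using haN)⟩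

end HNN

/-! ### Finite quotients of `ℤⁿ *_φ` -/

section FiniteQuotients

variable {n : ℕ} (φ : Module.End ℤ (Fin n → ℤ))

/-- The subgroup of those `a` such that some `φ ^ j a` is divisible by `q`. -/
def eventuallyDivisible (q : ℤ) : Submodule ℤ (Fin n → ℤ) where
  carrier := {a | ∃ (j : ℕ) (c : Fin n → ℤ), (φ ^ j) a = q • c}
  zero_mem' := ⟨0, 0, by simp⟩
  add_mem' := by
    rintro a b ⟨j, c, hc⟩ ⟨k, d, hd⟩
    refine ⟨k + j, (φ ^ k) c + (φ ^ j) d, ?_⟩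
    rw [map_add, pow_add, Module.End.mul_apply, hc, ← pow_add, add_comm k j, pow_add,
      Module.End.mul_apply, hd, map_smul, map_smul, smul_add]
  smul_mem' := by
    rintro m a ⟨j, c, hc⟩
    exact ⟨j, m • c, by rw [map_smul, hc, smul_comm]⟩

/-- The converse direction makes φ injective on A/D(q), hence a permutation of this finite set; on
A/qA it need not be one. -/
theorem map_mem_eventuallyDivisible {q : ℤ} {a : Fin n → ℤ} :
    φ a ∈ eventuallyDivisible φ q ↔ a ∈ eventuallyDivisible φ q := by
  constructor
  · rintro ⟨j, c, hc⟩
    exact ⟨j + 1, c, by rw [pow_succ, Module.End.mul_apply, hc]⟩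
  · rintro ⟨j, c, hc⟩
    refine ⟨j, φ c, ?_⟩
    rw [← Module.End.mul_apply, ← pow_succ, pow_succ', Module.End.mul_apply, hc, map_smul]

theorem smul_mem_eventuallyDivisible (q : ℤ) (a : Fin n → ℤ) :
    q • a ∈ eventuallyDivisible φ q := ⟨0, a, by simp⟩

theorem finite_quotient_eventuallyDivisible {q : ℤ} (hq : q ≠ 0) :
    Finite ((Fin n → ℤ) ⧸ eventuallyDivisible φ q) := by
  refine Module.finite_of_fg_torsion _ ?_
  intro x
  obtain ⟨a, rfl⟩ := Submodule.Quotient.mk_surjective (eventuallyDivisible φ q) x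
  refine ⟨⟨q, mem_nonZeroDivisors_of_ne_zero hq⟩, ?_⟩
  change q • (Submodule.Quotient.mk a : (Fin n → ℤ) ⧸ eventuallyDivisible φ q) = 0
  rw [← Submodule.Quotient.mk_smul, Submodule.Quotient.mk_eq_zero]
  exact smul_mem_eventuallyDivisible φ q a

/-- The permutation of `ℤⁿ / eventuallyDivisible φ q` induced by `φ`. -/
noncomputable def quotientPerm {q : ℤ} (hq : q ≠ 0) :
    Equiv.Perm ((Fin n → ℤ) ⧸ eventuallyDivisible φ q) :=
  have := finite_quotient_eventuallyDivisible φ hq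
  Equiv.ofBijective
    (Submodule.mapQ (eventuallyDivisible φ q) (eventuallyDivisible φ q) φ
      fun _ ha => (map_mem_eventuallyDivisible φ).2 ha) <|
    Finite.injective_iff_bijective.1 <| (injective_iff_map_eq_zero _).2 fun x hx => by
      obtain ⟨a, rfl⟩ := Submodule.Quotient.mk_surjective _ x
      rw [Submodule.mapQ_apply, Submodule.Quotient.mk_eq_zero, map_mem_eventuallyDivisible] at hx
      exact (Submodule.Quotient.mk_eq_zero _).2 hx

theorem quotientPerm_mk {q : ℤ} (hq : q ≠ 0) (a : Fin n → ℤ) :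
    quotientPerm φ hq (Submodule.Quotient.mk a) = Submodule.Quotient.mk (φ a) := rfl

/-- The action of `ℤⁿ` by translations on its quotient by a subgroup. -/
def translation (B : Submodule ℤ (Fin n → ℤ)) :
    Multiplicative (Fin n → ℤ) →* Equiv.Perm ((Fin n → ℤ) ⧸ B) where
  toFun a := Equiv.addLeft (Submodule.Quotient.mk a.toAdd)
  map_one' := by
    ext x
    simp
  map_mul' a b := by
    ext x
    simp

theorem translation_apply (B : Submodule ℤ (Fin n → ℤ)) (a : Multiplicative (Fin n → ℤ))
    (x : (Fin n → ℤ) ⧸ B) :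
    translation B a x = Submodule.Quotient.mk a.toAdd + x := rfl

/-- G acts on the finite set A/D(q), with A acting by translations and t as φ. The image of 0 under
a translation recovers the class of the translating element. -/
theorem separated_of_notMem {hφ : Function.Injective φ} {q : ℤ} (hq : q ≠ 0)
    {g a : Multiplicative (Fin n → ℤ)}
    (h : ∀ k : ℤ, a.toAdd - k • g.toAdd ∉ eventuallyDivisible φ q) :
    SeparatedFromZPowers (HNNExtension.of g : ZHNN φ hφ) (HNNExtension.of a) := by
  have := finite_quotient_eventuallyDivisible φ hq
  refine .of_hom (HNN.lift (translation (eventuallyDivisible φ q)) (quotientPerm φ hq) ?_)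
    fun k hk => h k ?_
  · intro b
    ext x
    obtain ⟨x, rfl⟩ := Submodule.Quotient.mk_surjective _ x
    rw [Equiv.Perm.mul_apply, Equiv.Perm.mul_apply, translation_apply, translation_apply,
      ← Submodule.Quotient.mk_add, quotientPerm_mk, quotientPerm_mk, map_add]
    rfl
  · have hk : translation (eventuallyDivisible φ q) a =
        translation (eventuallyDivisible φ q) g ^ k :=
      (HNN.lift_of _ _ _ a).symm.trans (hk.trans (congrArg (· ^ k) (HNN.lift_of _ _ _ g)))
    rw [← map_zpow] at hk
    have h0 := congrArg (fun e => e 0) hk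
    simp only [translation_apply, add_zero, toAdd_zpow] at h0
    exact (Submodule.Quotient.eq _).1 h0

end FiniteQuotients

/-! ### Separating cyclic subgroups of `ℤⁿ` -/

theorem pow_dvd_of_pow_add_dvd_mul {p : ℤ} (hp : Prime p) {k K : ℕ} {m x : ℤ}
    (hm : ¬ p ^ k ∣ m) (h : p ^ (k + K) ∣ m * x) : p ^ K ∣ x := by
  induction k generalizing m with
  | zero => simp at hm
  | succ k ih =>
    by_cases hpm : p ∣ m
    · obtain ⟨m, rfl⟩ := hpm
      refine ih (m := m) (fun h' => hm ?_) ?_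
      · rw [pow_succ']
        exact mul_dvd_mul_left p h'
      · rw [show k + 1 + K = (k + K) + 1 by ring, pow_succ', mul_assoc] at h
        exact (mul_dvd_mul_iff_left hp.ne_zero).1 h
    · exact (pow_dvd_pow p (by omega)).trans (hp.pow_dvd_of_dvd_mul_left _ hpm h)

theorem exists_prime_pow_dvd_not_dvd {c d : ℤ} (h : ¬ c ∣ d) :
    ∃ (p : ℕ) (k : ℕ), p.Prime ∧ (p : ℤ) ^ k ∣ c ∧ ¬ (p : ℤ) ^ k ∣ d := by
  by_contra! H
  apply h
  rw [← Int.natAbs_dvd_natAbs]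
  rw [Nat.dvd_iff_prime_pow_dvd_dvd]
  intro p k hp hpk
  have := H p k hp (by rw [← Int.natAbs_dvd_natAbs, Int.natAbs_pow]; simpa using hpk)
  rw [← Int.natAbs_dvd_natAbs, Int.natAbs_pow] at this
  simpa using this

section ZModules

variable {n : ℕ} (φ : Module.End ℤ (Fin n → ℤ))

theorem exists_smul_eq_iff {q : ℤ} {a : Fin n → ℤ} : (∃ c, a = q • c) ↔ ∀ i, q ∣ a i := by
  constructor
  · rintro ⟨c, rfl⟩ i
    exact ⟨c i, by simp⟩
  · intro h
    choose c hc using h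
    exact ⟨c, funext fun i => by simp [hc i]⟩

/-- An injective endomorphism of `ℤⁿ` is invertible modulo all but finitely many primes. -/
theorem exists_eventuallyDivisible_iff (hφ : Function.Injective φ) :
    ∃ N : ℤ, N ≠ 0 ∧ ∀ p : ℤ, Prime p → ¬ p ∣ N →
      ∀ a ∈ eventuallyDivisible φ p, ∃ c, a = p • c := by
  refine ⟨LinearMap.det φ, fun h0 => ?_, fun p hp hpN => ?_⟩
  · have := LinearMap.bot_lt_ker_of_det_eq_zero h0
    rw [LinearMap.ker_eq_bot.2 hφ] at this
    exact lt_irrefl _ this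
  -- Multiplying by the adjugate matrix turns φ(a) = p·c into det(φ)·a ∈ pA.
  · have key : ∀ a c, φ a = p • c → ∃ c, a = p • c := by
      intro a c hac
      set M := LinearMap.toMatrix' φ with hM
      have h1 : M.mulVec a = p • c := by rw [hM, LinearMap.toMatrix'_mulVec, hac]
      have h2 : M.det • a = p • M.adjugate.mulVec c := by
        have := congrArg M.adjugate.mulVec h1
        rw [Matrix.mulVec_mulVec, Matrix.adjugate_mul, Matrix.mulVec_smul, Matrix.smul_mulVec,
          Matrix.one_mulVec] at this
        exact this
      refine exists_smul_eq_iff.2 fun i => ?_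
      have h3 := congrFun h2 i
      simp only [Pi.smul_apply, smul_eq_mul] at h3
      rw [hM, LinearMap.det_toMatrix'] at h3
      exact (hp.dvd_or_dvd (Dvd.intro _ h3.symm)).resolve_left hpN
    rintro a ⟨j, c, hc⟩
    induction j generalizing c with
    | zero => exact ⟨c, by simpa using hc⟩
    | succ j ih =>
      rw [pow_succ', Module.End.mul_apply] at hc
      obtain ⟨c', hc'⟩ := key _ _ hc
      exact ih c' hc'

theorem isCyclicSubgroupSeparable_of_eventuallyDivisible (hφ : Function.Injective φ)
    (h : ∀ p : ℕ, p.Prime → ∀ a : Fin n → ℤ,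
      (∀ K : ℕ, a ∈ eventuallyDivisible φ ((p : ℤ) ^ K)) → a = 0) :
    IsCyclicSubgroupSeparable (ZHNN φ hφ) := by
  refine HNN.isCyclicSubgroupSeparable fun g' a' hga' => ?_
  set g : Fin n → ℤ := g'.toAdd with hg
  set a : Fin n → ℤ := a'.toAdd with ha
  have hga : ∀ k : ℤ, a ≠ k • g := fun k hk =>
    hga' k (Multiplicative.toAdd.injective (by rw [toAdd_zpow]; exact hk))
  suffices H : ∃ q : ℤ, q ≠ 0 ∧ ∀ k : ℤ, a - k • g ∉ eventuallyDivisible φ q by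
    obtain ⟨q, hq, H⟩ := H
    exact separated_of_notMem φ hq H
  by_cases hg0 : g = 0
  -- Here ⟨g⟩ is trivial and any prime would serve.
  · have ha0 : a ≠ 0 := by simpa [hg0] using hga 0
    have := mt (h 2 Nat.prime_two a) ha0
    push Not at this
    obtain ⟨K, hK⟩ := this
    exact ⟨(2 : ℕ) ^ K, by positivity, fun k => by simpa [hg0] using hK⟩
  obtain ⟨i, hi⟩ := Function.ne_iff.1 hg0
  rw [Pi.zero_apply] at hi
  -- In the dependent case g_i does not divide a_i; take p^k dividing g_i but not a_i, and K with g
  -- outside D(p^K). From (a_i - s·g_i)·g = g_i·(a - s·g), membership of a - s·g in D(p^K) would put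
  -- g there too, since p^k does not divide a_i - s·g_i.
  by_cases hdep : g i • a = a i • g
  · have hdvd : ¬ g i ∣ a i := by
      rintro ⟨s, hs⟩
      refine hga s (smul_right_injective _ hi ?_)
      simp only
      rw [hdep, hs, mul_smul]
    obtain ⟨p, k, hp, hpc, hpd⟩ := exists_prime_pow_dvd_not_dvd hdvd
    have hgp := mt (h p hp g) hg0
    push Not at hgp
    obtain ⟨K, hK⟩ := hgp
    have hp0 : (p : ℤ) ≠ 0 := by exact_mod_cast hp.ne_zero
    refine ⟨(p : ℤ) ^ K, pow_ne_zero _ hp0, ?_⟩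
    rintro s ⟨j, c, hc⟩
    refine hK ⟨j, exists_smul_eq_iff.2 fun l => ?_⟩
    have hm : ¬ (p : ℤ) ^ k ∣ a i - s * g i := fun hm =>
      hpd (by simpa using dvd_add hm (hpc.mul_left s))
    refine pow_dvd_of_pow_add_dvd_mul (Nat.prime_iff_prime_int.1 hp) hm ?_
    have h1 : (a i - s * g i) • g = g i • (a - s • g) := by
      rw [smul_sub, hdep, sub_smul, smul_smul, mul_comm]
    have h2 := congrFun (congrArg (φ ^ j) h1) l
    rw [map_smul, map_smul, hc] at h2
    simp only [Pi.smul_apply, smul_eq_mul] at h2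
    rw [h2, pow_add]
    exact mul_dvd_mul hpc (Dvd.intro _ rfl)
  -- In the independent case some 2×2 minor of (g, a) is nonzero. For p dividing neither it nor N,
  -- D(p) = pA, and a ≡ s·g mod p would make p divide the minor.
  · obtain ⟨l, hl⟩ := Function.ne_iff.1 hdep
    simp only [Pi.smul_apply, smul_eq_mul] at hl
    obtain ⟨N, hN0, hN⟩ := exists_eventuallyDivisible_iff φ hφ
    set D := N * (g i * a l - a i * g l) with hD
    have hD0 : D ≠ 0 := mul_ne_zero hN0 (sub_ne_zero.2 hl)
    obtain ⟨p, hpD, hp⟩ := Nat.exists_infinite_primes (D.natAbs + 1)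
    have hp' := Nat.prime_iff_prime_int.1 hp
    have hpD' : ¬ (p : ℤ) ∣ D := by
      intro hd
      have := Int.natAbs_le_of_dvd_ne_zero hd hD0
      rw [Int.natAbs_natCast] at this
      omega
    refine ⟨p, hp'.ne_zero, fun s hs => hpD' ?_⟩
    obtain ⟨c, hc⟩ := hN p hp' (fun h' => hpD' (h'.mul_right _)) _ hs
    have h1 := congrFun hc i
    have h2 := congrFun hc l
    simp only [Pi.sub_apply, Pi.smul_apply, smul_eq_mul] at h1 h2
    exact ⟨N * (g i * c l - c i * g l), by
      rw [hD]; linear_combination N * g i * h2 - N * g l * h1⟩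

end ZModules

/-! ### Integral points of invariant subspaces -/

section IntegralPoints

open Polynomial

variable {n : ℕ} (φ : Module.End ℤ (Fin n → ℤ))
  {U V : Submodule ℚ[X] (RatModule φ)}

/-- The inclusion `ℤⁿ ⊆ ℚⁿ` with values in the `ℚ[X]`-module `ℚⁿ`. -/
noncomputable def toRatModule : (Fin n → ℤ) →ₗ[ℤ] RatModule φ where
  toFun a := Module.AEval'.of (ratEnd φ) (toRat a)
  map_add' a b := by
    rw [← map_add]
    congr 1
    ext
    simp [toRat]
  map_smul' m a := by
    rw [RingHom.id_apply, ← map_zsmul]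
    congr 1
    ext
    simp [toRat]

theorem mem_inter_iff {a : Fin n → ℤ} : a ∈ inter φ V ↔ toRatModule φ a ∈ V := Iff.rfl

theorem toRatModule_injective : Function.Injective (toRatModule φ) := by
  intro a b hab
  have h : toRat a = toRat b := (Module.AEval'.of (ratEnd φ)).injective hab
  ext k
  have := congrFun h k
  simpa [toRat] using this

theorem exists_smul_eq_toRatModule (v : RatModule φ) :
    ∃ (N : ℤ) (a : Fin n → ℤ), N ≠ 0 ∧ N • v = toRatModule φ a := by
  obtain ⟨w, rfl⟩ := (Module.AEval'.of (ratEnd φ)).surjective v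
  obtain ⟨N, hN⟩ := IsLocalization.exist_integer_multiples_of_finite (nonZeroDivisors ℤ) w
  choose a ha using hN
  refine ⟨N, a, nonZeroDivisors.coe_ne_zero N, ?_⟩
  rw [← map_zsmul]
  change _ = Module.AEval'.of (ratEnd φ) (toRat a)
  congr 1
  ext k
  exact (ha k).symm

theorem map_smul_toRatModule (Q : ℤ[X]) (a : Fin n → ℤ) :
    Q.map (Int.castRingHom ℚ) • toRatModule φ a = toRatModule φ (aeval φ Q a) := by
  induction Q using Polynomial.induction_on' generalizing a with
  | add P Q hP hQ => rw [Polynomial.map_add, add_smul, hP, hQ, map_add, LinearMap.add_apply, map_add]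
  | monomial k m =>
    induction k generalizing a with
    | zero =>
      rw [map_monomial, monomial_zero_left, monomial_zero_left, aeval_C, Module.AEval.C_smul,
        Module.algebraMap_end_apply, map_smul]
      exact Int.cast_smul_eq_zsmul ℚ m _
    | succ k ih =>
      rw [← monomial_mul_X, Polynomial.map_mul, map_X, mul_smul, map_mul, aeval_X,
        Module.End.mul_apply, ← ih]
      congr 1
      change (X : ℚ[X]) • Module.AEval'.of (ratEnd φ) (toRat a) =
        Module.AEval'.of (ratEnd φ) (toRat (φ a))
      rw [Module.AEval'.X_smul_of, ratEnd_toRat]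

theorem int_smul_mem_iff {m : ℤ} (hm : m ≠ 0) {v : RatModule φ} : m • v ∈ V ↔ v ∈ V := by
  refine ⟨fun h => ?_, fun h => zsmul_mem h m⟩
  have h1 := V.smul_mem (C ((m : ℚ)⁻¹)) h
  rwa [Module.AEval.C_smul, ← Int.cast_smul_eq_zsmul ℚ, smul_smul, inv_mul_cancel₀ (by simpa),
    one_smul] at h1

/-- Purity of V ∩ A, which later allows powers of p to be cancelled. -/
theorem smul_mem_inter_iff {m : ℤ} (hm : m ≠ 0) {a : Fin n → ℤ} :
    m • a ∈ inter φ V ↔ a ∈ inter φ V := by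
  rw [mem_inter_iff, mem_inter_iff, map_smul, int_smul_mem_iff φ hm]

theorem aeval_mem_inter (Q : ℤ[X]) {a : Fin n → ℤ} (ha : a ∈ inter φ V) :
    aeval φ Q a ∈ inter φ V := by
  rw [mem_inter_iff, ← map_smul_toRatModule]
  exact V.smul_mem _ ha

theorem exists_mem_inter_of_lt (h : U < V) : ∃ a ∈ inter φ V, a ∉ inter φ U := by
  obtain ⟨v, hvV, hvU⟩ := SetLike.exists_of_lt h
  obtain ⟨N, a, hN, ha⟩ := exists_smul_eq_toRatModule φ v
  refine ⟨a, ?_, ?_⟩ <;> rw [mem_inter_iff, ← ha, int_smul_mem_iff φ hN] <;> assumption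

/-- Nothing lies strictly between U and V, so U and e generate V over ℚ[X]; N clears the
denominators of the polynomial coefficient. -/
theorem exists_smul_eq_add_of_covBy (h : U ⋖ V) {e a : Fin n → ℤ} (heV : e ∈ inter φ V)
    (heU : e ∉ inter φ U) (ha : a ∈ inter φ V) :
    ∃ N : ℤ, N ≠ 0 ∧ ∃ b ∈ inter φ U, ∃ Q : ℤ[X], N • a = b + aeval φ Q e := by
  have hsup : U ⊔ Submodule.span ℚ[X] {toRatModule φ e} = V := by
    refine (h.eq_or_eq le_sup_left (sup_le h.le ?_)).resolve_left fun h0 => heU ?_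
    · rwa [Submodule.span_singleton_le_iff_mem]
    · rw [mem_inter_iff, ← h0]
      exact Submodule.mem_sup_right (Submodule.mem_span_singleton_self _)
  have ha' : toRatModule φ a ∈ U ⊔ Submodule.span ℚ[X] {toRatModule φ e} := by rwa [hsup]
  obtain ⟨u, hu, w, hw, huw⟩ := Submodule.mem_sup.1 ha'
  obtain ⟨q, rfl⟩ := Submodule.mem_span_singleton.1 hw
  obtain ⟨N, hN, hQ⟩ := IsLocalization.integerNormalization_spec (nonZeroDivisors ℤ) q
  have hN0 : N ≠ 0 := nonZeroDivisors.ne_zero hN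
  set Q := IsLocalization.integerNormalization (nonZeroDivisors ℤ) q
  replace hQ : Q.map (Int.castRingHom ℚ) = N • q := hQ
  refine ⟨N, hN0, N • a - aeval φ Q e, ?_, Q, by simp⟩
  rw [mem_inter_iff, map_sub, map_smul, ← map_smul_toRatModule, hQ, ← huw, zsmul_add,
    smul_assoc, add_sub_cancel_right]
  exact zsmul_mem hu N

theorem aeval_mem_eventuallyDivisible {q : ℤ} (Q : ℤ[X]) {a : Fin n → ℤ}
    (ha : a ∈ eventuallyDivisible φ q) : aeval φ Q a ∈ eventuallyDivisible φ q := by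
  induction Q using Polynomial.induction_on generalizing a with
  | C m => simpa using Submodule.smul_mem _ m ha
  | add P Q hP hQ => simpa using Submodule.add_mem _ (hP ha) (hQ ha)
  | monomial k m ih =>
    rw [pow_succ, ← mul_assoc, map_mul, aeval_X, Module.End.mul_apply]
    exact ih ((map_mem_eventuallyDivisible φ).2 ha)

theorem exists_eq_pow_mul_isCoprime {p : ℕ} (hp : p.Prime) {N : ℤ} (hN : N ≠ 0) :
    ∃ (u : ℕ) (v : ℤ), N = (p : ℤ) ^ u * v ∧ IsCoprime (p : ℤ) v := by
  have hp' := Nat.prime_iff_prime_int.1 hp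
  obtain ⟨v, h, hv⟩ := (FiniteMultiplicity.of_prime_left hp' hN).exists_eq_pow_mul_and_not_dvd
  exact ⟨_, v, h, hp'.coprime_iff_not_dvd.2 hv⟩

/-- Modulo U, a multiple N·a is Q(φ)(e), and Q(φ)(e) also lies in every D(p^K). The p-part of N is
cancelled by purity of U ∩ A, and its prime-to-p part is inverted modulo p. -/
theorem inter_subset_absorbed {p : ℕ} (hp : p.Prime) (h : U ⋖ V) {e : Fin n → ℤ}
    (heV : e ∈ inter φ V) (heU : e ∉ inter φ U)
    (he : ∀ K : ℕ, e ∈ eventuallyDivisible φ ((p : ℤ) ^ K)) :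
    (inter φ V : Set (Fin n → ℤ)) ⊆ absorbed φ (inter φ U) p := by
  intro a ha
  obtain ⟨N, hN, b, hb, Q, hNa⟩ := exists_smul_eq_add_of_covBy φ h heV heU ha
  obtain ⟨u, v, rfl, α, β, hαβ⟩ := exists_eq_pow_mul_isCoprime hp hN
  have hp0 : (p : ℤ) ≠ 0 := by exact_mod_cast hp.ne_zero
  -- Of the u + 1 factors p, u cancel against N and one remains.
  obtain ⟨j, c, hc⟩ := aeval_mem_eventuallyDivisible φ Q (he (u + 1))
  have h1 : (p : ℤ) ^ u • (v • (φ ^ j) a - (p : ℤ) • c) = (φ ^ j) b := by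
    have := congrArg (φ ^ j) hNa
    rw [map_add, hc, map_smul] at this
    rw [smul_sub, smul_smul, this, smul_smul, ← pow_succ]
    simp
  have h2 : v • (φ ^ j) a - (p : ℤ) • c ∈ inter φ U := by
    rw [← smul_mem_inter_iff φ (pow_ne_zero u hp0), h1]
    simpa using aeval_mem_inter φ (X ^ j) hb
  refine ⟨j, β • (v • (φ ^ j) a - (p : ℤ) • c), Submodule.smul_mem _ _ h2,
    α • (φ ^ j) a + β • c, ?_⟩
  calc (φ ^ j) a = (α * p + β * v) • (φ ^ j) a := by rw [hαβ, one_smul]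
    _ = _ := by module

theorem exists_mem_succ_notMem_castSucc
    (V : CompositionSeries (Submodule ℚ[X] (RatModule φ)))
    (hV₀ : V.head = ⊥) (hV₁ : V.last = ⊤) {e : Fin n → ℤ} (he : e ≠ 0) :
    ∃ i : Fin V.length, e ∈ inter φ (V i.succ) ∧ e ∉ inter φ (V i.castSucc) := by
  by_contra! H
  have h : ∀ j : Fin (V.length + 1), e ∈ inter φ (V j) := by
    intro j
    induction j using Fin.reverseInduction with
    | last =>
      change toRatModule φ e ∈ V.last
      rw [hV₁]
      trivial
    | cast i ih => exact H i ih
  have h0 : toRatModule φ e ∈ V.head := h 0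
  rw [hV₀, Submodule.mem_bot] at h0
  exact he (toRatModule_injective φ (by rw [h0, map_zero]))

theorem isCyclicSubgroupSeparable_of_not_absorbed (hφ : Function.Injective φ)
    (V : CompositionSeries (Submodule ℚ[X] (RatModule φ)))
    (hV₀ : V.head = ⊥) (hV₁ : V.last = ⊤)
    (h : ¬ ∃ p : ℕ, p.Prime ∧ ∃ i : Fin V.length,
      (inter φ (V i.succ) : Set (Fin n → ℤ)) ⊆ absorbed φ (inter φ (V i.castSucc)) p) :
    IsCyclicSubgroupSeparable (ZHNN φ hφ) := by
  refine isCyclicSubgroupSeparable_of_eventuallyDivisible φ hφ fun p hp e he => ?_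
  by_contra he0
  obtain ⟨i, hi, hi'⟩ := exists_mem_succ_notMem_castSucc φ V hV₀ hV₁ he0
  exact h ⟨p, hp, i, inter_subset_absorbed φ hp (V.step i) hi hi' he⟩

end IntegralPoints

/-! ### Characteristic polynomials of the factors -/

section Charpoly

open Polynomial

/-- In a basis adapted to W the matrix of f is block upper triangular. -/
theorem charpoly_eq_charpoly_restrict_mul_charpoly_mapQ {R M : Type*} [CommRing R]
    [AddCommGroup M] [Module R M] [Module.Finite R M] [Module.Free R M] (W : Submodule R M)
    [Module.Free R W] [Module.Finite R W] [Module.Free R (M ⧸ W)] (f : Module.End R M)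
    (hf : W ≤ W.comap f) :
    f.charpoly = LinearMap.charpoly (f.restrict hf) * LinearMap.charpoly (W.mapQ W f hf) := by
  let bW := Module.Free.chooseBasis R W
  let bQ := Module.Free.chooseBasis R (M ⧸ W)
  let b := Module.Basis.sumQuot bW bQ
  let B := Matrix.of fun i l => (b.repr (f (b (Sum.inr l)))) (Sum.inl i)
  have hb : LinearMap.toMatrix b b f = Matrix.fromBlocks
      (LinearMap.toMatrix bW bW (f.restrict hf)) B 0 (LinearMap.toMatrix bQ bQ (W.mapQ W f hf)) := by
    ext u v
    rcases u with i | j <;> rcases v with k | l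
    · simp only [b, Module.Basis.sumQuot_inl, Matrix.fromBlocks_apply₁₁, LinearMap.toMatrix_apply]
      apply Module.Basis.sumQuot_repr_inl_of_mem
    · simp [B, LinearMap.toMatrix_apply]
    · have h0 : W.mkQ (f (bW k)) = 0 := by
        rw [← LinearMap.mem_ker, Submodule.ker_mkQ]
        exact hf (Submodule.coe_mem (bW k))
      simp [b, LinearMap.toMatrix_apply, h0]
    · simp only [b, LinearMap.toMatrix_apply, Module.Basis.sumQuot_repr_inr,
        Matrix.fromBlocks_apply₂₂]
      rw [← Module.Basis.sumQuot_inr bW bQ l, Submodule.mkQ_apply, Submodule.mapQ_apply]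
  rw [← LinearMap.charpoly_toMatrix f b, hb, Matrix.charpoly_fromBlocks_zero₂₁,
    LinearMap.charpoly_toMatrix, LinearMap.charpoly_toMatrix]

theorem charpoly_eq_one_of_subsingleton {R M : Type*} [CommRing R] [Nontrivial R]
    [AddCommGroup M] [Module R M] [Module.Finite R M] [Module.Free R M] [Subsingleton M]
    (f : Module.End R M) : f.charpoly = 1 :=
  f.charpoly_monic.natDegree_eq_zero.1 <| by
    rw [LinearMap.charpoly_natDegree, Module.finrank_zero_of_subsingleton]

theorem eq_prod_of_eq_mul {M : Type*} [CommMonoid M] {m : ℕ} (f : Fin (m + 1) → M) (g : Fin m → M)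
    (h₀ : f 0 = 1) (h : ∀ i, f i.succ = f i.castSucc * g i) : f (Fin.last m) = ∏ i, g i := by
  induction m with
  | zero => simpa using h₀
  | succ m ih =>
    rw [Fin.prod_univ_castSucc, ← Fin.succ_last, h,
      ← ih (fun i => f i.castSucc) (fun i => g i.castSucc) h₀ fun i => h i.castSucc]

variable {n : ℕ} (φ : Module.End ℤ (Fin n → ℤ)) {U V : Submodule ℚ[X] (RatModule φ)}

/-- The characteristic polynomial of the restriction of `φ` to `V ∩ ℤⁿ`. -/
noncomputable def interPoly (V : Submodule ℚ[X] (RatModule φ)) : ℤ[X] :=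
  LinearMap.charpoly (φ.restrict (inter_invariant φ V))

theorem inter_mono (h : U ≤ V) : inter φ U ≤ inter φ V := fun _ ha => h ha

theorem interPoly_eq_mul (h : U ≤ V) : interPoly φ V = interPoly φ U * factorPoly φ U V := by
  have hf : (inter φ U).submoduleOf (inter φ V) ≤
      ((inter φ U).submoduleOf (inter φ V)).comap (φ.restrict (inter_invariant φ V)) :=
    fun a ha => inter_invariant φ U _ ha
  rw [interPoly, charpoly_eq_charpoly_restrict_mul_charpoly_mapQ
    ((inter φ U).submoduleOf (inter φ V)) (φ.restrict (inter_invariant φ V)) hf]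
  congr 1
  rw [interPoly, ← LinearEquiv.charpoly_conj (Submodule.submoduleOfEquivOfLe (inter_mono φ h))]
  congr 1

theorem interPoly_bot : interPoly φ ⊥ = 1 := by
  have : Subsingleton (inter φ ⊥) := by
    refine ⟨fun a b => Subtype.ext (toRatModule_injective φ ?_)⟩
    rw [(Submodule.mem_bot _).1 ((mem_inter_iff φ).1 a.2),
      (Submodule.mem_bot _).1 ((mem_inter_iff φ).1 b.2)]
  exact charpoly_eq_one_of_subsingleton _

theorem interPoly_top : interPoly φ ⊤ = LinearMap.charpoly φ := by
  have h : inter φ ⊤ = ⊤ := by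
    ext a
    simp [mem_inter_iff]
  rw [interPoly, ← LinearEquiv.charpoly_conj (LinearEquiv.ofTop _ h)]
  congr 1

theorem charpoly_eq_prod_factorPoly (V : CompositionSeries (Submodule ℚ[X] (RatModule φ)))
    (hV₀ : V.head = ⊥) (hV₁ : V.last = ⊤) :
    LinearMap.charpoly φ = ∏ i : Fin V.length, factorPoly φ (V i.castSucc) (V i.succ) := by
  rw [← interPoly_top, ← hV₁]
  refine eq_prod_of_eq_mul (fun j => interPoly φ (V j)) _ ?_ fun i =>
    interPoly_eq_mul φ (V.step i).le
  change interPoly φ V.head = 1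
  rw [hV₀, interPoly_bot]

theorem aeval_factorEnd_mk (Q : ℤ[X]) (a : inter φ V) :
    aeval (factorEnd φ U V) Q (Submodule.Quotient.mk a) =
      Submodule.Quotient.mk ⟨aeval φ Q a, aeval_mem_inter φ Q a.2⟩ := by
  induction Q using Polynomial.induction_on generalizing a with
  | C m =>
    rw [aeval_C, Module.algebraMap_end_apply, ← Submodule.Quotient.mk_smul]
    congr 1
    ext1
    simp
  | add P Q hP hQ =>
    rw [map_add, LinearMap.add_apply, hP, hQ, ← Submodule.Quotient.mk_add]
    congr 1
    ext1
    simp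
  | monomial k m ih =>
    rw [pow_succ, ← mul_assoc, map_mul, aeval_X, Module.End.mul_apply]
    refine (ih ⟨φ a, inter_invariant φ V _ a.2⟩).trans ?_
    congr 1
    ext1
    simp only [map_mul, aeval_X, Module.End.mul_apply]

theorem mk_factor_eq_zero {a : inter φ V} :
    (Submodule.Quotient.mk a : Factor φ U V) = 0 ↔ (a : Fin n → ℤ) ∈ inter φ U :=
  Submodule.Quotient.mk_eq_zero _

theorem aeval_factorPoly_mem {a : Fin n → ℤ} (ha : a ∈ inter φ V) :
    aeval φ (factorPoly φ U V) a ∈ inter φ U := by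
  have h := aeval_factorEnd_mk φ (U := U) (factorPoly φ U V) ⟨a, ha⟩
  rw [factorPoly, LinearMap.aeval_self_charpoly, LinearMap.zero_apply, eq_comm,
    mk_factor_eq_zero] at h
  exact h

theorem finrank_int_le_finrank_rat {F M : Type*} [AddCommGroup F] [Module.Free ℤ F]
    [Module.Finite ℤ F] [AddCommGroup M] [Module ℚ M] [Module.Finite ℚ M] (g : F →ₗ[ℤ] M)
    (hg : Function.Injective g) : Module.finrank ℤ F ≤ Module.finrank ℚ M := by
  have hli := (Module.Free.chooseBasis ℤ F).linearIndependent.map' g (LinearMap.ker_eq_bot.2 hg)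
  rw [LinearIndependent.iff_fractionRing ℤ ℚ] at hli
  rw [Module.finrank_eq_card_chooseBasisIndex]
  exact hli.fintype_card_le_finrank

/-- The simple module V/U is ℚ[X]/(π) with π irreducible. By Cayley–Hamilton f annihilates it, so π
divides f, and deg f ≤ deg π makes them associated. -/
theorem irreducible_factorPoly (h : U ⋖ V) :
    Irreducible ((factorPoly φ U V).map (Int.castRingHom ℚ)) := by
  set f := factorPoly φ U V with hf
  have hsimple := (covBy_iff_quot_is_simple h.le).1 h
  obtain ⟨I, hI, ⟨E⟩⟩ := isSimpleModule_iff_quot_maximal.1 hsimple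
  obtain ⟨π, hπ⟩ := (IsPrincipalIdealRing.principal I).principal
  change I = Ideal.span {π} at hπ
  subst hπ
  have hfm : f.Monic := LinearMap.charpoly_monic _
  have hf0 : f.map (Int.castRingHom ℚ) ≠ 0 := (hfm.map _).ne_zero
  have hdvd : π ∣ f.map (Int.castRingHom ℚ) := by
    rw [← Ideal.mem_span_singleton, ← Ideal.annihilator_quotient (I := Ideal.span {π}),
      ← E.annihilator_eq, Module.mem_annihilator]
    intro x
    obtain ⟨⟨v, hv⟩, rfl⟩ := Submodule.Quotient.mk_surjective _ x
    rw [← Submodule.Quotient.mk_smul, Submodule.Quotient.mk_eq_zero]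
    change f.map (Int.castRingHom ℚ) • v ∈ U
    obtain ⟨N, a, hN, ha⟩ := exists_smul_eq_toRatModule φ v
    rw [← int_smul_mem_iff φ hN, smul_comm, ha, map_smul_toRatModule]
    refine aeval_factorPoly_mem φ ?_
    rw [mem_inter_iff, ← ha]
    exact zsmul_mem hv N
  have hπ0 : π ≠ 0 := by
    rintro rfl
    exact hf0 (zero_dvd_iff.1 hdvd)
  have hπirr : Irreducible π :=
    ((Ideal.span_singleton_prime hπ0).1 hI.isPrime).irreducible
  -- The degree of f is the rank of the integral factor, which embeds in ℚ[X]/(π), of dimension deg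
  -- π.
  have hdeg : f.natDegree ≤ π.natDegree := by
    rw [hf, factorPoly, LinearMap.charpoly_natDegree,
      ← finrank_quotient_span_eq_natDegree (f := π)]
    have : Module.Finite ℚ (ℚ[X] ⧸ Ideal.span {π}) := by
      refine Module.finite_of_finrank_pos ?_
      rw [finrank_quotient_span_eq_natDegree]
      exact hπirr.natDegree_pos
    let g₀ : inter φ V →+ ℚ[X] ⧸ Ideal.span {π} :=
      AddMonoidHom.mk' (fun a => E (Submodule.Quotient.mk ⟨toRatModule φ a, a.2⟩)) fun a b => by
        rw [← map_add, ← Submodule.Quotient.mk_add]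
        congr 2
        ext1
        exact map_add (toRatModule φ) _ _
    have hg₀ : ∀ a, g₀ a = 0 ↔ a ∈ (inter φ U).submoduleOf (inter φ V) := by
      intro a
      rw [AddMonoidHom.mk'_apply, map_eq_zero_iff E E.injective, Submodule.Quotient.mk_eq_zero]
      rfl
    refine finrank_int_le_finrank_rat
      (((inter φ U).submoduleOf (inter φ V)).liftQ g₀.toIntLinearMap fun a ha => (hg₀ a).2 ha) ?_
    refine (injective_iff_map_eq_zero _).2 fun x hx => ?_
    obtain ⟨a, rfl⟩ := Submodule.Quotient.mk_surjective _ x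
    exact (Submodule.Quotient.mk_eq_zero _).2 ((hg₀ a).1 hx)
  refine (associated_of_dvd_of_natDegree_le hdvd hf0 ?_).irreducible hπirr
  rwa [hfm.natDegree_map]

/-- Absorption says that each element of the factor is sent into p times the factor by some power of
φ. After base change to `ZMod p` every vector is thus killed by a power, which characterises the
characteristic polynomial X^n. -/
theorem factorPoly_map_eq_X_pow (hUV : U ≤ V) {p : ℕ} (hp : p.Prime)
    (h : (inter φ V : Set (Fin n → ℤ)) ⊆ absorbed φ (inter φ U) p) :
    (factorPoly φ U V).map (Int.castRingHom (ZMod p)) = X ^ Module.finrank ℤ (Factor φ U V) := by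
  have := Fact.mk hp
  have hp0 : (p : ℤ) ≠ 0 := by exact_mod_cast hp.ne_zero
  have key : ∀ x : Factor φ U V, ∃ (j : ℕ) (y : Factor φ U V),
      (factorEnd φ U V ^ j) x = (p : ℤ) • y := by
    intro x
    obtain ⟨⟨a, ha⟩, rfl⟩ := Submodule.Quotient.mk_surjective _ x
    obtain ⟨j, b, hb, c, hc⟩ := h ha
    -- By purity c then lies in V ∩ A, so p·c is p times an element of the factor.
    have hpc : (p : ℤ) • c ∈ inter φ V := by
      rw [← sub_eq_iff_eq_add'.2 hc]
      exact sub_mem (by simpa using aeval_mem_inter φ (X ^ j) ha) (inter_mono φ hUV hb)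
    refine ⟨j, Submodule.Quotient.mk ⟨c, (smul_mem_inter_iff φ hp0).1 hpc⟩, ?_⟩
    rw [← aeval_X_pow (R := ℤ), aeval_factorEnd_mk, ← Submodule.Quotient.mk_smul]
    refine (Submodule.Quotient.eq _).2 ?_
    change aeval φ (X ^ j : ℤ[X]) a - (p : ℤ) • c ∈ inter φ U
    rwa [aeval_X_pow, hc, add_sub_cancel_right]
  change (factorPoly φ U V).map (algebraMap ℤ (ZMod p)) = _
  rw [factorPoly, ← LinearMap.charpoly_baseChange,
    ← Module.finrank_baseChange (R := ZMod p) (M' := Factor φ U V),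
    LinearMap.charpoly_eq_X_pow_iff]
  have hpow : ∀ (j : ℕ) (r : ZMod p) (x : Factor φ U V),
      ((factorEnd φ U V).baseChange (ZMod p) ^ j) (r ⊗ₜ[ℤ] x) =
        r ⊗ₜ[ℤ] (factorEnd φ U V ^ j) x := by
    intro j r x
    rw [← LinearMap.baseChange_pow, LinearMap.baseChange_tmul]
  intro m
  induction m using TensorProduct.induction_on with
  | zero => exact ⟨0, by simp⟩
  | tmul r x =>
    obtain ⟨j, y, hy⟩ := key x
    refine ⟨j, ?_⟩
    rw [hpow, hy, TensorProduct.tmul_smul, TensorProduct.smul_tmul']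
    simp
  | add x y hx hy =>
    obtain ⟨j, hj⟩ := hx
    obtain ⟨k, hk⟩ := hy
    refine ⟨k + j, ?_⟩
    rw [map_add, pow_add, Module.End.mul_apply, hj, ← pow_add, add_comm k j, pow_add,
      Module.End.mul_apply, hk]
    simp

/-- By Cayley–Hamilton f(φ) maps V ∩ A into U ∩ A, whose rank is strictly smaller, so it has a
kernel. -/
theorem exists_ne_zero_aeval_factorPoly_eq_zero (h : U < V) :
    ∃ a : Fin n → ℤ, a ≠ 0 ∧ aeval φ (factorPoly φ U V) a = 0 := by
  set f := factorPoly φ U V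
  by_contra! H
  let L : inter φ V →ₗ[ℤ] inter φ U :=
    (aeval φ f).restrict fun a ha => aeval_factorPoly_mem φ ha
  have hL : Function.Injective L := by
    refine (injective_iff_map_eq_zero L).2 fun a ha => ?_
    by_contra ha0
    exact H a (by simpa using ha0) (congrArg Subtype.val ha)
  have h1 := LinearMap.finrank_le_finrank_of_injective hL
  have h2 : Module.finrank ℤ (Factor φ U V) + _ = _ :=
    Submodule.finrank_quotient_add_finrank ((inter φ U).submoduleOf (inter φ V))
  rw [(Submodule.submoduleOfEquivOfLe (inter_mono φ h.le)).finrank_eq] at h2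
  obtain ⟨e, he, he'⟩ := exists_mem_inter_of_lt φ h
  have : Nontrivial (Factor φ U V) :=
    ⟨Submodule.Quotient.mk ⟨e, he⟩, 0, fun h0 => he' ((mk_factor_eq_zero φ).1 h0)⟩
  have h3 : 0 < Module.finrank ℤ (Factor φ U V) := Module.finrank_pos
  omega

/-- The inclusion `ℤⁿ ⊆ ℤⁿ *_φ`. -/
noncomputable def ofInt (hφ : Function.Injective φ) : (Fin n → ℤ) →+ Additive (ZHNN φ hφ) :=
  AddMonoidHom.mk' (fun a => Additive.ofMul (HNNExtension.of (Multiplicative.ofAdd a))) fun a b =>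
    congrArg Additive.ofMul (map_mul HNNExtension.of (Multiplicative.ofAdd a) (.ofAdd b))

theorem ofInt_injective (hφ : Function.Injective φ) : Function.Injective (ofInt φ hφ) :=
  fun _ _ h => HNNExtension.of_injective (G := Multiplicative (Fin n → ℤ)) _ h

theorem ofInt_zsmul (hφ : Function.Injective φ) (k : ℤ) (a : Fin n → ℤ) :
    (ofInt φ hφ (k • a)).toMul = (ofInt φ hφ a).toMul ^ k := by
  rw [map_zsmul, toMul_zsmul]

theorem ofInt_pow_apply_mem_iff {hφ : Function.Injective φ} {N : Subgroup (ZHNN φ hφ)}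
    (hN : N.Normal) (j : ℕ) (a : Fin n → ℤ) :
    (ofInt φ hφ ((φ ^ j) a)).toMul ∈ N ↔ (ofInt φ hφ a).toMul ∈ N := by
  have h : ∀ b, (ofInt φ hφ (φ b)).toMul =
      HNNExtension.t * (ofInt φ hφ b).toMul * HNNExtension.t⁻¹ := fun b =>
    eq_mul_inv_of_mul_eq (t_mul_of' (Multiplicative.ofAdd b)).symm
  have hconj : ∀ t x : ZHNN φ hφ, t * x * t⁻¹ ∈ N ↔ x ∈ N := fun t x => by
    rw [hN.mem_comm_iff, inv_mul_cancel_left]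
  induction j with
  | zero => rfl
  | succ j ih =>
    rw [pow_succ', Module.End.mul_apply, h]
    exact (hconj _ _).trans ih

/-- Otherwise, for some a ≠ 0, the cyclic subgroup ⟨pa⟩ is not closed: a lies outside it but in its
closure. -/
theorem factorPoly_map_ne_X_pow (hφ : Function.Injective φ)
    (hsep : IsCyclicSubgroupSeparable (ZHNN φ hφ)) (h : U < V) {p : ℕ} (hp : p.Prime) (m : ℕ) :
    (factorPoly φ U V).map (Int.castRingHom (ZMod p)) ≠ X ^ m := by
  intro hm
  obtain ⟨a, ha0, ha⟩ := exists_ne_zero_aeval_factorPoly_eq_zero φ h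
  obtain ⟨g, hg⟩ : ∃ g : ℤ[X], X ^ m = factorPoly φ U V + C (p : ℤ) * g := by
    have : C (p : ℤ) ∣ X ^ m - factorPoly φ U V := by
      rw [C_dvd_iff_dvd_coeff]
      intro i
      have := congrArg (fun q => coeff q i) hm
      simp only [coeff_map, eq_intCast] at this
      rw [← ZMod.intCast_zmod_eq_zero_iff_dvd, coeff_sub, Int.cast_sub, this]
      simp [coeff_X_pow]
    obtain ⟨g, hg⟩ := this
    exact ⟨g, by rw [← hg]; ring⟩
  have hφm : (φ ^ m) a = (p : ℤ) • aeval φ g a := by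
    have := congrArg (fun q => aeval φ q a) hg
    simpa [ha] using this
  -- The quotient by p^u is kept as a polynomial in φ applied to a, so that it commutes with φ^m and
  -- the relation for φ^m(a) can be reused.
  have hφmu : ∀ u : ℕ, ∃ G : ℤ[X], (φ ^ (m * u)) a = (p : ℤ) ^ u • aeval φ G a := by
    intro u
    induction u with
    | zero => exact ⟨1, by simp⟩
    | succ u ih =>
      obtain ⟨G, hG⟩ := ih
      refine ⟨G * g, ?_⟩
      have hcomm : (φ ^ m) (aeval φ G a) = aeval φ G ((φ ^ m) a) := by
        rw [← aeval_X_pow (R := ℤ) φ, ← Module.End.mul_apply, ← Module.End.mul_apply, ← map_mul,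
          ← map_mul, mul_comm]
      rw [mul_add, mul_one, add_comm, pow_add, Module.End.mul_apply, hG, map_smul, hcomm, hφm,
        map_smul, smul_smul, ← pow_succ, map_mul, Module.End.mul_apply]
  have hnot : (ofInt φ hφ a).toMul ∉
      (Subgroup.zpowers (ofInt φ hφ ((p : ℤ) • a)).toMul : Set (ZHNN φ hφ)) := by
    rintro ⟨k, hk⟩
    have hk : (ofInt φ hφ ((p : ℤ) • a)).toMul ^ k = (ofInt φ hφ a).toMul := hk
    rw [← ofInt_zsmul] at hk
    have h1 : k • ((p : ℤ) • a) = a := ofInt_injective φ hφ hk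
    obtain ⟨i, hi⟩ := Function.ne_iff.1 ha0
    have h2 := congrFun h1 i
    simp only [Pi.smul_apply, smul_eq_mul] at h2
    have h3 : (p : ℤ) ∣ 1 :=
      ⟨k, mul_right_cancel₀ hi (by linear_combination -h2)⟩
    exact (Nat.prime_iff_prime_int.1 hp).not_isUnit (isUnit_of_dvd_one h3)
  obtain ⟨N, hN, hNf, hsepN⟩ := (hsep _).exists_normal hnot
  obtain ⟨u, v, hNuv, α, β, hαβ⟩ :=
    exists_eq_pow_mul_isCoprime hp (Int.natCast_ne_zero.2 hNf.index_ne_zero)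
  -- With index p^u·v, the element φ^{mu}(v·a) is the index times an element of A, hence in N; v·a
  -- is conjugate to it.
  have hva : (ofInt φ hφ (v • a)).toMul ∈ N := by
    obtain ⟨G, hG⟩ := hφmu u
    rw [← ofInt_pow_apply_mem_iff φ hN (m * u), map_smul, hG, smul_smul, mul_comm, ← hNuv,
      ofInt_zsmul, zpow_natCast]
    exact Subgroup.pow_index_mem N _
  refine hsepN _ ⟨α, rfl⟩ ?_
  -- Bézout's α·p + β·v = 1 gives a ≡ α·(p·a) modulo N, against the choice of N.
  have h5 : -a + α • ((p : ℤ) • a) = -β • (v • a) := by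
    have : (α * p + β * v) • a = a := by rw [hαβ, one_smul]
    nth_rewrite 1 [← this]
    module
  have h4 : (ofInt φ hφ a).toMul⁻¹ * (ofInt φ hφ ((p : ℤ) • a)).toMul ^ α ∈ N := by
    rw [← ofInt_zsmul, ← toMul_neg, ← toMul_add, ← map_neg, ← map_add, h5, ofInt_zsmul]
    exact N.zpow_mem hva _
  exact h4

end Charpoly

end AscHNN

theorem theorem4p1 (n : ℕ) (φ : Module.End ℤ (Fin n → ℤ)) (hφ : Function.Injective φ)
    (V : CompositionSeries (Submodule (Polynomial ℚ) (AscHNN.RatModule φ)))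
    (hV₀ : V.head = ⊥) (hV₁ : V.last = ⊤) :
    (∀ i : Fin V.length,
      (AscHNN.factorPoly φ (V i.castSucc) (V i.succ)).Monic ∧
      (AscHNN.factorPoly φ (V i.castSucc) (V i.succ)).natDegree =
        Module.finrank ℤ (AscHNN.Factor φ (V i.castSucc) (V i.succ)) ∧
      Irreducible ((AscHNN.factorPoly φ (V i.castSucc) (V i.succ)).map (Int.castRingHom ℚ))) ∧
    LinearMap.charpoly φ = ∏ i : Fin V.length, AscHNN.factorPoly φ (V i.castSucc) (V i.succ) ∧
    List.TFAE
      [ AscHNN.IsCyclicSubgroupSeparable (AscHNN.ZHNN φ hφ),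
        ¬ ∃ p : ℕ, p.Prime ∧ ∃ i : Fin V.length,
          (AscHNN.inter φ (V i.succ) : Set (Fin n → ℤ)) ⊆
            AscHNN.absorbed φ (AscHNN.inter φ (V i.castSucc)) p,
        ¬ ∃ p : ℕ, p.Prime ∧ ∃ i : Fin V.length,
          (AscHNN.factorPoly φ (V i.castSucc) (V i.succ)).map (Int.castRingHom (ZMod p)) =
            Polynomial.X ^
              Module.finrank ℤ (AscHNN.Factor φ (V i.castSucc) (V i.succ)) ] := by
  refine ⟨fun i => ⟨LinearMap.charpoly_monic _, LinearMap.charpoly_natDegree _,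
    AscHNN.irreducible_factorPoly φ (V.step i)⟩,
    AscHNN.charpoly_eq_prod_factorPoly φ V hV₀ hV₁, ?_⟩
  tfae_have 1 → 3 := by
    rintro hsep ⟨p, hp, i, hi⟩
    exact AscHNN.factorPoly_map_ne_X_pow φ hφ hsep (V.step i).lt hp _ hi
  tfae_have 3 → 2 := by
    rintro h ⟨p, hp, i, hi⟩
    exact h ⟨p, hp, i, AscHNN.factorPoly_map_eq_X_pow φ (V.step i).le hp hi⟩
  tfae_have 2 → 1 := AscHNN.isCyclicSubgroupSeparable_of_not_absorbed φ hφ V hV₀ hV₁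
  tfae_finish
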